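/- Let $n\ge 4$ and let $\mathbb R^{n+1}_1$ be Minkowski space with scalar product $\langle x,y\rangle=x_1y_1+\dots+x_ny_n-x_{n+1}y_{n+1}$. Let $F:M\to\mathbb R^{n+1}_1$ be a smooth space-like hypersurface, i.e. $M$ is a smooth $n$-dimensional manifold, $F$ is smooth, and the induced metric $g=F^*\langle\cdot,\cdot\rangle$ is positive definite. Assume that $(M,g)$ is conformally flat (every point has a coordinate neighbourhood in which $g$ is a smooth positive multiple of the Euclidean metric) and that $M$ has no umbilical point, i.e. its shape operator is nowhere a multiple of the identity. Then, near every point at which the shape operator has rank at least $2$ (equivalently, at which the curvature tensor of $g$ is not zero), $M$ is a part of a canal space-like hypersurface. In particular, if the shape operator has rank at least $2$ everywhere, then $M$ is locally a part of a canal space-like hypersurface. Here a space-like hypersurface is called canal if it is a smooth one-parameter family, with parameter $s$ in an open interval $J$, of $(n-1)$-dimensional (not necessarily complete) pieces of spheres of codimension two, namely of cross-sections $\{X:\langle X-z(s),X-z(s)\rangle=-R(s)^2\}\cap\{X:\langle X,v(s)\rangle=c(s)\}$ of space-like hyperspheres of radius $R(s)>0$ with hyperplanes ($v(s)\neq0$),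 with $z,R,v,c$ smooth on $J$, such that for every $s$ the normal lines of the hypersurface at the points of the piece with parameter $s$ all pass through the point $z(s)$. -/

import Mathlib

open scoped Manifold ContDiff Topology

noncomputable section

namespace Minkowski

/-- The underlying real vector space, with its usual topology and smooth structure, of the
`(n+1)`-dimensional Minkowski space. Its geometry is given by `Minkowski.form`; the Euclidean norm
of this type only serves to speak of smoothness. -/
abbrev Space (n : ℕ) : Type := EuclideanSpace ℝ (Fin (n + 1))

/-- The Lorentzian scalar product `x₁y₁ + ⋯ + xₙyₙ - xₙ₊₁yₙ₊₁`. -/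
def form {n : ℕ} (x y : Space n) : ℝ :=
  (∑ i : Fin n, x i.castSucc * y i.castSucc) - x (Fin.last n) * y (Fin.last n)

/-- The space-like hypersphere with centre `z` and radius `R`: `(X - z)² = -R²`. -/
def hypersphere {n : ℕ} (z : Space n) (R : ℝ) : Set (Space n) :=
  {X | form (X - z) (X - z) = -R ^ 2}

/-- The affine hyperplane `⟨X, v⟩ = c`; it is used with `v ≠ 0`, and every hyperplane has this form
because the scalar product is nondegenerate. -/
def hyperplane {n : ℕ} (v : Space n) (c : ℝ) : Set (Space n) :=
  {X | form X v = c}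

variable {n : ℕ} {M : Type*} [TopologicalSpace M] [ChartedSpace (EuclideanSpace ℝ (Fin n)) M]

/-- The differential of a map from `M` to Minkowski space. -/
def differential (F : M → Space n) (p : M) : TangentSpace (𝓡 n) p →L[ℝ] Space n :=
  mfderiv (𝓡 n) 𝓘(ℝ, Space n) F p

/-- The first fundamental form of `F : M → ℝⁿ⁺¹₁`. -/
def inducedMetric (F : M → Space n) (p : M) (v w : TangentSpace (𝓡 n) p) : ℝ :=
  form (differential F p v) (differential F p w)

/-- `F : M → ℝⁿ⁺¹₁` is an (immersed) space-like hypersurface: `M` has dimension `n`, `F` is smooth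
and the induced metric is positive definite (so that `F` is an immersion). -/
def IsSpacelikeHypersurface (F : M → Space n) : Prop :=
  ContMDiff (𝓡 n) 𝓘(ℝ, Space n) ∞ F ∧
    ∀ (p : M) (v : TangentSpace (𝓡 n) p), v ≠ 0 → 0 < inducedMetric F p v v

/-- The differential of a map from `M` to Euclidean space, with values in Euclidean space. -/
def chartDifferential (e : M → EuclideanSpace ℝ (Fin n)) (p : M) :
    TangentSpace (𝓡 n) p →L[ℝ] EuclideanSpace ℝ (Fin n) :=
  mfderiv (𝓡 n) 𝓘(ℝ, EuclideanSpace ℝ (Fin n)) e p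

/-- A metric tensor `g` on `M` is conformally flat if every point lies in the domain of a smooth
chart `e` in which `g` is a smooth positive multiple of the Euclidean metric. -/
def IsConformallyFlat
    (g : ∀ p : M, TangentSpace (𝓡 n) p → TangentSpace (𝓡 n) p → ℝ) : Prop :=
  ∀ p : M, ∃ e ∈ IsManifold.maximalAtlas (𝓡 n) ∞ M, p ∈ e.source ∧
    ∃ lam : M → ℝ, ContMDiffOn (𝓡 n) 𝓘(ℝ, ℝ) ∞ lam e.source ∧
      ∀ q ∈ e.source, 0 < lam q ∧ ∀ v w : TangentSpace (𝓡 n) q,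
        g q v w = lam q * inner ℝ (chartDifferential e q v) (chartDifferential e q w)

/-- `A` is the shape operator of `F` at `p` for one of the two local unit (time-like) normal fields
`N`: it is given by the Weingarten formula `dF (A v) = - dN v`. -/
def IsShapeOperatorAt (F : M → Space n) (p : M)
    (A : TangentSpace (𝓡 n) p →ₗ[ℝ] TangentSpace (𝓡 n) p) : Prop :=
  ∃ N : M → Space n, ContMDiffAt (𝓡 n) 𝓘(ℝ, Space n) ∞ N p ∧
    (∀ᶠ q in 𝓝 p, form (N q) (N q) = -1 ∧
      ∀ w : TangentSpace (𝓡 n) q, form (N q) (differential F q w) = 0) ∧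
    ∀ v : TangentSpace (𝓡 n) p, differential F p (A v) = -differential N p v

/-- `p` is an umbilical point: the shape operator at `p` is a multiple of the identity. -/
def IsUmbilicalPoint (F : M → Space n) (p : M) : Prop :=
  ∃ A, IsShapeOperatorAt F p A ∧ ∃ c : ℝ, ∀ v, A v = c • v

/-- The shape operator at `p` has rank at least two. It is determined up to sign, so that its rank
is well defined. -/
def HasShapeRankAtLeastTwo (F : M → Space n) (p : M) : Prop :=
  ∃ A, IsShapeOperatorAt F p A ∧ 2 ≤ Module.finrank ℝ (LinearMap.range A)

/-- The open piece `F|U` of a space-like hypersurface is a canal space-like hypersurface.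
It is a smooth one-parameter family of spherical generators, the level sets of the submersion
`s : U → J`, where `J` is an open interval. The generator with parameter `t` is a piece of
dimension `n - 1` of a sphere of codimension two, namely of the cross-section of the space-like
hypersphere with centre `z t` and radius `R t` with the hyperplane `⟨X, v t⟩ = c t`; and at each of
its points the normal line of the hypersurface passes through the fixed point `z t`. The generators
need not be complete spheres: an envelope is in general singular somewhere on the whole sphere. -/
def IsCanalOn (F : M → Space n) (U : Set M) : Prop :=
  ∃ (J : Set ℝ) (s : M → ℝ) (z : ℝ → Space n) (R : ℝ → ℝ) (v : ℝ → Space n) (c : ℝ → ℝ),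
    IsOpen J ∧ J.OrdConnected ∧ s '' U = J ∧
    ContMDiffOn (𝓡 n) 𝓘(ℝ, ℝ) ∞ s U ∧
    (∀ x ∈ U, mfderiv (𝓡 n) 𝓘(ℝ, ℝ) s x ≠ 0) ∧
    ContDiffOn ℝ ∞ z J ∧ ContDiffOn ℝ ∞ R J ∧ ContDiffOn ℝ ∞ v J ∧ ContDiffOn ℝ ∞ c J ∧
    (∀ t ∈ J, 0 < R t ∧ v t ≠ 0) ∧
    ∀ x ∈ U,
      F x ∈ hypersphere (z (s x)) (R (s x)) ∩ hyperplane (v (s x)) (c (s x)) ∧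
      ∀ w : TangentSpace (𝓡 n) x, form (F x - z (s x)) (differential F x w) = 0

end Minkowski

end

/-! In a conformally flat chart the hypersurface becomes a map `f` from an open set of Euclidean
space whose induced metric is `ρ` times the Euclidean one. On four pairwise orthogonal directions
the Gauss equation loses all its metric terms and becomes h(a,c)h(b,d) = h(a,d)h(b,c) for the second
form h (`gauss_of_orthogonal`). Testing this on combinations of eigenvectors shows, in dimension at
least four, that all eigenvalues of h but at most one coincide (`exists_quasiumbilical_form`): the
hypersurface is quasiumbilical.

Without umbilical points the multiple principal curvature `l` is a smooth function
(`exists_smooth_principal_curvature`), and dN + l df has rank one. The kernel of this map is the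
principal distribution, and Codazzi makes `l` constant along it
(`dirDeriv_principal_curvature_eq_zero`). Rank at least two forces `l ≠ 0`, so the focal point ζ = f
+ N/l is defined nearby. Its differential vanishes on the distribution, and so does that of 1/l.

A linear functional of ζ therefore serves as the parameter `s`, and both ζ and 1/l are smooth
functions of `s` (`exists_factor_of_ker_le`). The centre is ζ and the radius is |1/l|.
Differentiating the sphere equation in `s` gives the hyperplane, with conormal the derivative of the
centre (`exists_canal`). -/

namespace Minkowski

/-! ### Calculus of directional derivatives with constant directions. -/

section Calculus

variable {E G W : Type*} [NormedAddCommGroup E] [NormedSpace ℝ E]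
  [NormedAddCommGroup G] [NormedSpace ℝ G] [NormedAddCommGroup W] [NormedSpace ℝ W]

/-- The derivative of `f` in the constant direction `v`, as a function of the base point. -/
noncomputable def dirDeriv (v : E) (f : E → G) (x : E) : G := fderiv ℝ f x v

variable {V : Set E} {f g : E → G} {x : E}

theorem differentiableAt_of_contDiffOn (hV : IsOpen V) (hf : ContDiffOn ℝ ∞ f V) (hx : x ∈ V) :
    DifferentiableAt ℝ f x :=
  (hf.contDiffAt (hV.mem_nhds hx)).differentiableAt (by simp)

theorem contDiffOn_dirDeriv (hV : IsOpen V) (hf : ContDiffOn ℝ ∞ f V) (v : E) :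
    ContDiffOn ℝ ∞ (dirDeriv v f) V :=
  (hf.fderiv_of_isOpen hV (m := ∞) (by simp)).clm_apply contDiffOn_const

theorem dirDeriv_congr (hV : IsOpen V) (h : Set.EqOn f g V) (v : E) :
    Set.EqOn (dirDeriv v f) (dirDeriv v g) V := fun x hx => by
  unfold dirDeriv
  rw [(Filter.eventuallyEq_of_mem (hV.mem_nhds hx) h).fderiv_eq]

theorem dirDeriv_const (v : E) (c : G) (x : E) : dirDeriv v (fun _ : E => c) x = 0 := by
  simp [dirDeriv]

theorem dirDeriv_comm (hV : IsOpen V) (hf : ContDiffOn ℝ ∞ f V) (hx : x ∈ V) (v w : E) :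
    dirDeriv v (dirDeriv w f) x = dirDeriv w (dirDeriv v f) x := by
  have hf' : DifferentiableAt ℝ (fderiv ℝ f) x :=
    differentiableAt_of_contDiffOn hV (hf.fderiv_of_isOpen hV (m := ∞) (by simp)) hx
  have key (a b : E) : dirDeriv a (dirDeriv b f) x = fderiv ℝ (fderiv ℝ f) x a b := by
    change fderiv ℝ (fun y => fderiv ℝ f y b) x a = _
    rw [fderiv_clm_apply hf' (differentiableAt_const b)]
    simp
  rw [key, key]
  exact ((hf.contDiffAt (hV.mem_nhds hx)).isSymmSndFDerivAt
    (by
      rw [minSmoothness_of_isRCLikeNormedField]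
      exact WithTop.coe_le_coe.2 (le_top (a := (2 : ℕ∞))))).eq v w

theorem dirDeriv_bilin (B : G →L[ℝ] G →L[ℝ] W) (hf : DifferentiableAt ℝ f x)
    (hg : DifferentiableAt ℝ g x) (v : E) :
    dirDeriv v (fun y => B (f y) (g y)) x = B (dirDeriv v f x) (g x) + B (f x) (dirDeriv v g x) := by
  unfold dirDeriv
  have := (B.hasFDerivAt_of_bilinear hf.hasFDerivAt hg.hasFDerivAt).fderiv
  rw [this]
  simp [add_comm]

theorem dirDeriv_smul {m : E → ℝ} (hm : DifferentiableAt ℝ m x) (hf : DifferentiableAt ℝ f x)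
    (v : E) : dirDeriv v (fun y => m y • f y) x = m x • dirDeriv v f x + dirDeriv v m x • f x := by
  unfold dirDeriv
  rw [fderiv_fun_smul hm hf]
  simp

theorem dirDeriv_add (hf : DifferentiableAt ℝ f x) (hg : DifferentiableAt ℝ g x) (v : E) :
    dirDeriv v (fun y => f y + g y) x = dirDeriv v f x + dirDeriv v g x := by
  unfold dirDeriv
  rw [fderiv_fun_add hf hg]
  simp

theorem dirDeriv_comp_real {γ : ℝ → G} {s : E → ℝ} (hγ : DifferentiableAt ℝ γ (s x))
    (hs : DifferentiableAt ℝ s x) (w : E) :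
    dirDeriv w (fun y => γ (s y)) x = dirDeriv w s x • deriv γ (s x) := by
  unfold dirDeriv
  rw [show (fun y => γ (s y)) = γ ∘ s from rfl, (hγ.hasFDerivAt.comp x hs.hasFDerivAt).fderiv]
  simp [fderiv_eq_smul_deriv]

theorem contDiffOn_bilin (B : G →L[ℝ] G →L[ℝ] W) (hf : ContDiffOn ℝ ∞ f V)
    (hg : ContDiffOn ℝ ∞ g V) : ContDiffOn ℝ ∞ (fun y => B (f y) (g y)) V :=
  B.isBoundedBilinearMap.contDiff.comp_contDiffOn (hf.prodMk hg)

end Calculus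

/-! ### Linear algebra of quasiumbilical symmetric forms. -/

section Algebra

variable {E : Type*} [NormedAddCommGroup E] [InnerProductSpace ℝ E] [FiniteDimensional ℝ E]

theorem exists_ne_zero_of_two_functionals (hE : 3 ≤ Module.finrank ℝ E) (φ ψ : E →ₗ[ℝ] ℝ) :
    ∃ v : E, v ≠ 0 ∧ φ v = 0 ∧ ψ v = 0 := by
  have h : LinearMap.ker (φ.prod ψ) ≠ ⊥ := LinearMap.ker_ne_bot_of_finrank_lt (by simp; omega)
  obtain ⟨v, hv, hv0⟩ := Submodule.exists_mem_ne_zero_of_ne_bot h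
  have := LinearMap.mem_ker.1 hv
  exact ⟨v, hv0, congrArg Prod.fst this, congrArg Prod.snd this⟩

theorem exists_unit_orthogonal (hE : 3 ≤ Module.finrank ℝ E) (a b : E) :
    ∃ v : E, inner ℝ v v = 1 ∧ inner ℝ a v = 0 ∧ inner ℝ b v = 0 := by
  obtain ⟨v, hv, h1, h2⟩ :=
    exists_ne_zero_of_two_functionals hE (innerₛₗ ℝ a) (innerₛₗ ℝ b)
  simp only [innerₛₗ_apply_apply] at h1 h2
  refine ⟨‖v‖⁻¹ • v, ?_, ?_, ?_⟩
  · rw [real_inner_smul_left, real_inner_smul_right, real_inner_self_eq_norm_sq]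
    field_simp [norm_ne_zero_iff.2 hv]
  · rw [real_inner_smul_right, h1, mul_zero]
  · rw [real_inner_smul_right, h2, mul_zero]

/-- Serves to read off the coefficients of κ⟨v,w⟩ + d⟨u,v⟩⟨u,w⟩: on two different vectors of the
triple the κ-term drops out and the value is d. -/
theorem exists_orthogonal_triple (hE : 3 ≤ Module.finrank ℝ E) {u : E} (hu : inner ℝ u u = 1) :
    ∃ a b c : E, inner ℝ a b = 0 ∧ inner ℝ a c = 0 ∧ inner ℝ b c = 0 ∧
      inner ℝ u a = 1 ∧ inner ℝ u b = 1 ∧ inner ℝ u c = 1 := by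
  obtain ⟨p, hp, hup, -⟩ := exists_unit_orthogonal hE u u
  obtain ⟨q, hq, huq, hpq⟩ := exists_unit_orthogonal hE u p
  have hpu := real_inner_comm p u
  have hqu := real_inner_comm q u
  have hqp := real_inner_comm q p
  refine ⟨u + p + q, u - p, u + p - (2 : ℝ) • q, ?_, ?_, ?_, ?_, ?_, ?_⟩ <;>
  simp only [inner_add_left, inner_add_right, inner_sub_left, inner_sub_right,
      real_inner_smul_right] <;> linarith

/-- If κ i ≠ κ l, the relation forces all other values to agree. Pairing i and l with two of the
remaining indices then makes κ i or κ l equal to that common value; this is where a fourth index is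
needed. -/
theorem exists_exceptional_index {ι : Type*} [Fintype ι] (hι : 4 ≤ Fintype.card ι) (κ : ι → ℝ)
    (h : ∀ i j k l : ι, i ≠ j → i ≠ k → i ≠ l → j ≠ k → j ≠ l → k ≠ l →
      (κ i - κ l) * (κ j - κ k) = 0) :
    ∃ (i₀ : ι) (c : ℝ), ∀ i, i ≠ i₀ → κ i = c := by
  classical
  have hne : Nonempty ι := Fintype.card_pos_iff.1 (by omega)
  have hex (s : Finset ι) (hs : s.card ≤ 3) : ∃ i, i ∉ s := by
    by_contra! hc
    have : s = Finset.univ := Finset.eq_univ_iff_forall.2 hc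
    rw [this, Finset.card_univ] at hs
    omega
  by_cases hall : ∀ i l, κ i = κ l
  · exact ⟨Classical.arbitrary ι, κ (Classical.arbitrary ι), fun i _ => hall _ _⟩
  push Not at hall
  obtain ⟨i, l, hil⟩ := hall
  have hil' : i ≠ l := fun e => hil (e ▸ rfl)
  obtain ⟨j, hj⟩ := hex {i, l} (Finset.card_le_two.trans (by norm_num))
  simp only [Finset.mem_insert, Finset.mem_singleton, not_or] at hj
  obtain ⟨k, hk⟩ := hex {i, l, j} Finset.card_le_three
  simp only [Finset.mem_insert, Finset.mem_singleton, not_or] at hk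
  have hrest (m : ι) (hmi : m ≠ i) (hml : m ≠ l) : κ m = κ j := by
    by_cases hmj : m = j
    · rw [hmj]
    have := h i m j l hmi.symm (Ne.symm hj.1) hil' hmj hml hj.2
    rcases mul_eq_zero.1 this with h0 | h0
    · exact absurd (sub_eq_zero.1 h0) hil
    · exact sub_eq_zero.1 h0
  have hkj := hrest k hk.1 hk.2.1
  have := h i l k j hil' (Ne.symm hk.1) (Ne.symm hj.1) (Ne.symm hk.2.1) (Ne.symm hj.2) hk.2.2
  rw [hkj] at this
  rcases mul_eq_zero.1 this with h0 | h0
  · refine ⟨l, κ j, fun m hm => ?_⟩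
    by_cases hmi : m = i
    · rw [hmi]; exact sub_eq_zero.1 h0
    · exact hrest m hmi hm
  · refine ⟨i, κ j, fun m hm => ?_⟩
    by_cases hml : m = l
    · rw [hml]; exact sub_eq_zero.1 h0
    · exact hrest m hm hml

/-- A symmetric bilinear form, in dimension at least four, whose curvature-like tensor vanishes on
pairwise orthogonal vectors has an eigenvalue of multiplicity at least `dim E - 1`. -/
theorem exists_quasiumbilical_form (hE : 4 ≤ Module.finrank ℝ E) (h : E →ₗ[ℝ] E →ₗ[ℝ] ℝ)
    (hsymm : ∀ v w, h v w = h w v)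
    (hcurv : ∀ a b c d : E, inner ℝ a b = 0 → inner ℝ a c = 0 → inner ℝ a d = 0 →
      inner ℝ b c = 0 → inner ℝ b d = 0 → inner ℝ c d = 0 → h a c * h b d = h a d * h b c) :
    ∃ (κ d : ℝ) (u : E), inner ℝ u u = 1 ∧
      ∀ v w, h v w = κ * inner ℝ v w + d * (inner ℝ u v * inner ℝ u w) := by
  -- The self-adjoint operator representing `h`, to be diagonalised.
  let T : E →ₗ[ℝ] E :=
    { toFun := fun v => (InnerProductSpace.toDual ℝ E).symm (LinearMap.toContinuousLinearMap (h v))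
      map_add' := fun v w => by simp
      map_smul' := fun r v => by simp }
  have hT (v w : E) : inner ℝ (T v) w = h v w := by
    change inner ℝ ((InnerProductSpace.toDual ℝ E).symm _) w = _
    rw [InnerProductSpace.toDual_symm_apply]
    rfl
  have hTs : T.IsSymmetric := fun v w => by
    rw [hT, hsymm, real_inner_comm, hT]
  let e := hTs.eigenvectorBasis rfl
  let μ := hTs.eigenvalues rfl
  have he (i j) : inner ℝ (e i) (e j) = if i = j then (1 : ℝ) else 0 :=
    orthonormal_iff_ite.1 e.orthonormal i j
  have hTe (i) : T (e i) = μ i • e i := by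
    exact hTs.apply_eigenvectorBasis rfl i
  have hhe (i j) : h (e i) (e j) = if i = j then μ i else 0 := by
    rw [← hT, hTe, real_inner_smul_left, he]
    simp
  obtain ⟨i₀, c, hc⟩ := exists_exceptional_index (by simpa using hE) μ
    (fun i j k l hij hik hil hjk hjl hkl => by
      -- These four vectors are pairwise orthogonal. Here h(a,c) = μ i - μ l and h(b,d) = μ j - μ k,
      -- while the mixed terms vanish.
      have := hcurv (e i + e l) (e j + e k) (e i - e l) (e j - e k)
      simp only [inner_add_left, inner_add_right, inner_sub_left, inner_sub_right, map_add, map_sub,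
        LinearMap.add_apply, he, hhe, hij, hik, hil, hjk, hjl, hkl, hij.symm,
        hik.symm, hil.symm, hjk.symm, hjl.symm, hkl.symm, if_true, if_false] at this
      norm_num at this
      simpa using this)
  refine ⟨c, μ i₀ - c, e i₀, by simp, fun v w => ?_⟩
  have hv (i) : μ i * (inner ℝ (e i) v * inner ℝ (e i) w) =
      c * (inner ℝ v (e i) * inner ℝ (e i) w) +
        if i = i₀ then (μ i₀ - c) * (inner ℝ (e i₀) v * inner ℝ (e i₀) w) else 0 := by
    rw [real_inner_comm (e i) v]
    split_ifs with hi
    · subst hi; ring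
    · rw [hc i hi]; ring
  have hsum : h v w = ∑ i, μ i * (inner ℝ (e i) v * inner ℝ (e i) w) := by
    rw [← hT, ← e.sum_inner_mul_inner]
    refine Finset.sum_congr rfl fun i _ => ?_
    rw [hTs, hTe, real_inner_smul_right, real_inner_comm (e i) v]
    ring
  rw [hsum, Finset.sum_congr rfl fun i _ => hv i, Finset.sum_add_distrib, ← Finset.mul_sum,
    e.sum_inner_mul_inner]
  simp

end Algebra

/-! ### Gauss, Weingarten and Codazzi equations in a conformal chart. -/

section Hypersurface

variable {E W : Type*} [NormedAddCommGroup E] [InnerProductSpace ℝ E]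
  [NormedAddCommGroup W] [NormedSpace ℝ W]

/-- `f : V → W` is a smooth immersion whose induced metric, with respect to the symmetric form `B`,
is `ρ` times the Euclidean metric, and `N` is a smooth unit time-like normal field along `f`. -/
structure IsConformalImmersion (B : W →L[ℝ] W →L[ℝ] ℝ) (V : Set E) (f : E → W) (ρ : E → ℝ)
    (N : E → W) : Prop where
  symm : ∀ X Y, B X Y = B Y X
  isOpen : IsOpen V
  smooth : ContDiffOn ℝ ∞ f V
  smooth_factor : ContDiffOn ℝ ∞ ρ V
  smooth_normal : ContDiffOn ℝ ∞ N V
  pos : ∀ x ∈ V, 0 < ρ x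
  conformal : ∀ x ∈ V, ∀ v w : E, B (dirDeriv v f x) (dirDeriv w f x) = ρ x * inner ℝ v w
  unit : ∀ x ∈ V, B (N x) (N x) = -1
  normal : ∀ x ∈ V, ∀ v : E, B (N x) (dirDeriv v f x) = 0

namespace IsConformalImmersion

variable {B : W →L[ℝ] W →L[ℝ] ℝ} {V : Set E} {f N : E → W} {ρ : E → ℝ} {x : E}

theorem mono (H : IsConformalImmersion B V f ρ N) {V' : Set E} (hV' : IsOpen V') (h : V' ⊆ V) :
    IsConformalImmersion B V' f ρ N where
  symm := H.symm
  isOpen := hV'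
  smooth := H.smooth.mono h
  smooth_factor := H.smooth_factor.mono h
  smooth_normal := H.smooth_normal.mono h
  pos := fun x hx => H.pos x (h hx)
  conformal := fun x hx => H.conformal x (h hx)
  unit := fun x hx => H.unit x (h hx)
  normal := fun x hx => H.normal x (h hx)

theorem differentiableAt (H : IsConformalImmersion B V f ρ N) (hx : x ∈ V) :
    DifferentiableAt ℝ f x := differentiableAt_of_contDiffOn H.isOpen H.smooth hx

theorem differentiableAt_dirDeriv (H : IsConformalImmersion B V f ρ N) (hx : x ∈ V) (v : E) :
    DifferentiableAt ℝ (dirDeriv v f) x :=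
  differentiableAt_of_contDiffOn H.isOpen (contDiffOn_dirDeriv H.isOpen H.smooth v) hx

theorem differentiableAt_factor (H : IsConformalImmersion B V f ρ N) (hx : x ∈ V) :
    DifferentiableAt ℝ ρ x := differentiableAt_of_contDiffOn H.isOpen H.smooth_factor hx

theorem differentiableAt_normal (H : IsConformalImmersion B V f ρ N) (hx : x ∈ V) :
    DifferentiableAt ℝ N x := differentiableAt_of_contDiffOn H.isOpen H.smooth_normal hx

theorem dirDeriv_injective (H : IsConformalImmersion B V f ρ N) (hx : x ∈ V) {v : E}
    (h : dirDeriv v f x = 0) : v = 0 := by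
  have := H.conformal x hx v v
  rw [h, map_zero] at this
  simpa [(H.pos x hx).ne'] using this.symm

/-- The map (a, t) ↦ df a + tN is injective, by pairing with N and then using conformality; equality
of dimensions makes it onto. Nondegeneracy of `B` need not be assumed. -/
theorem eq_tangent_add_normal [FiniteDimensional ℝ E] [FiniteDimensional ℝ W]
    (H : IsConformalImmersion B V f ρ N) (hx : x ∈ V)
    (hd : Module.finrank ℝ W = Module.finrank ℝ E + 1) (X : W) :
    ∃ (a : E) (t : ℝ), X = dirDeriv a f x + t • N x := by
  let L : E × ℝ →ₗ[ℝ] W :=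
    (fderiv ℝ f x : E →ₗ[ℝ] W).coprod (LinearMap.toSpanSingleton ℝ W (N x))
  have hL (q : E × ℝ) : L q = dirDeriv q.1 f x + q.2 • N x := by simp [L, dirDeriv]
  have hinj : Function.Injective L := by
    refine (injective_iff_map_eq_zero L).2 fun q hq => ?_
    rw [hL] at hq
    have h2 := congrArg (B (N x)) hq
    simp only [map_add, map_smul, map_zero, H.normal x hx, H.unit x hx, smul_eq_mul] at h2
    have h3 : q.2 = 0 := by linarith
    rw [h3, zero_smul, add_zero] at hq
    exact Prod.ext (H.dirDeriv_injective hx hq) h3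
  have hsurj : Function.Surjective L :=
    (LinearMap.injective_iff_surjective_of_finrank_eq_finrank (by simp [hd])).1 hinj
  obtain ⟨q, hq⟩ := hsurj X
  exact ⟨q.1, q.2, by rw [← hL, hq]⟩

/-- Koszul's formula: differentiate the conformality relation in three cyclically chosen ways and
combine. -/
theorem bilin_dirDeriv_dirDeriv (H : IsConformalImmersion B V f ρ N) (hx : x ∈ V) (c a m : E) :
    B (dirDeriv c (dirDeriv a f) x) (dirDeriv m f x) =
      (dirDeriv c ρ x * inner ℝ a m + dirDeriv a ρ x * inner ℝ c m
        - dirDeriv m ρ x * inner ℝ a c) / 2 := by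
  have key (c a m : E) : B (dirDeriv c (dirDeriv a f) x) (dirDeriv m f x) +
      B (dirDeriv c (dirDeriv m f) x) (dirDeriv a f x) = dirDeriv c ρ x * inner ℝ a m := by
    have h1 := dirDeriv_congr H.isOpen (fun y hy => H.conformal y hy a m) c hx
    have h2 := dirDeriv_smul (H.differentiableAt_factor hx)
      (differentiableAt_const (inner ℝ a m : ℝ)) c
    simp only [smul_eq_mul, dirDeriv_const, mul_zero, zero_add] at h2
    rw [h2, dirDeriv_bilin B (H.differentiableAt_dirDeriv hx a) (H.differentiableAt_dirDeriv hx m),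
      H.symm (dirDeriv a f x)] at h1
    exact h1
  have k1 := key c a m
  have k2 := key a c m
  have k3 := key m a c
  rw [dirDeriv_comm H.isOpen H.smooth hx a c, dirDeriv_comm H.isOpen H.smooth hx a m] at k2
  rw [dirDeriv_comm H.isOpen H.smooth hx m c] at k3
  linarith

theorem bilin_dirDeriv_normal (H : IsConformalImmersion B V f ρ N) (hx : x ∈ V) (c a : E) :
    B (dirDeriv c (dirDeriv a f) x) (N x) = -B (dirDeriv a f x) (dirDeriv c N x) := by
  have h1 := dirDeriv_congr H.isOpen (fun y hy => H.normal y hy a) c hx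
  rw [dirDeriv_bilin B (H.differentiableAt_normal hx) (H.differentiableAt_dirDeriv hx a),
    dirDeriv_const, H.symm, H.symm (N x)] at h1
  linarith

/-- The second fundamental form of a conformal immersion at a point. -/
noncomputable def secondForm (B : W →L[ℝ] W →L[ℝ] ℝ) (f N : E → W) (x : E) : E →ₗ[ℝ] E →ₗ[ℝ] ℝ :=
  LinearMap.mk₂ ℝ (fun v w => -B (dirDeriv v f x) (dirDeriv w N x))
    (by intros; simp [dirDeriv]; ring) (by intros; simp [dirDeriv])
    (by intros; simp [dirDeriv]; ring) (by intros; simp [dirDeriv])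

theorem secondForm_apply (v w : E) :
    secondForm B f N x v w = -B (dirDeriv v f x) (dirDeriv w N x) := rfl

theorem secondForm_eq (H : IsConformalImmersion B V f ρ N) (hx : x ∈ V) (v w : E) :
    secondForm B f N x v w = B (dirDeriv w (dirDeriv v f) x) (N x) := by
  rw [secondForm_apply, H.bilin_dirDeriv_normal hx]

theorem secondForm_symm (H : IsConformalImmersion B V f ρ N) (hx : x ∈ V) (v w : E) :
    secondForm B f N x v w = secondForm B f N x w v := by
  rw [H.secondForm_eq hx, H.secondForm_eq hx, dirDeriv_comm H.isOpen H.smooth hx]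

theorem contDiffOn_secondForm (H : IsConformalImmersion B V f ρ N) (v w : E) :
    ContDiffOn ℝ ∞ (fun x => secondForm B f N x v w) V :=
  (contDiffOn_bilin B (contDiffOn_dirDeriv H.isOpen H.smooth v)
    (contDiffOn_dirDeriv H.isOpen H.smooth_normal w)).neg

/-- The Gauss equation on orthogonal vectors. -/
theorem gauss_of_orthogonal [FiniteDimensional ℝ E] [FiniteDimensional ℝ W]
    (H : IsConformalImmersion B V f ρ N) (hx : x ∈ V)
    (hd : Module.finrank ℝ W = Module.finrank ℝ E + 1) {a b c d : E}
    (hab : inner ℝ a b = 0) (hac : inner ℝ a c = 0) (had : inner ℝ a d = 0)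
    (hbc : inner ℝ b c = 0) (hbd : inner ℝ b d = 0) (hcd : inner ℝ c d = 0) :
    secondForm B f N x a c * secondForm B f N x b d =
      secondForm B f N x a d * secondForm B f N x b c := by
  have hflip {v w : E} (h : inner ℝ v w = 0) : inner ℝ w v = 0 := by rw [real_inner_comm, h]
  -- By Koszul the tangential part of the second derivative along a and c lies in the span of a and
  -- c, and `q` is orthogonal to both. Only the normal parts contribute, with a minus sign since N
  -- is time-like.
  have hprod {a b c d : E} (hab : inner ℝ a b = 0) (hac : inner ℝ a c = 0)
      (had : inner ℝ a d = 0) (hbc : inner ℝ b c = 0) (hbd : inner ℝ b d = 0)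
      (hcd : inner ℝ c d = 0) :
      B (dirDeriv c (dirDeriv a f) x) (dirDeriv d (dirDeriv b f) x) =
        -(secondForm B f N x a c * secondForm B f N x b d) := by
    obtain ⟨q, t, hq⟩ := H.eq_tangent_add_normal hx hd (dirDeriv d (dirDeriv b f) x)
    have h1 : inner ℝ q a = 0 := by
      have := H.bilin_dirDeriv_dirDeriv hx d b a
      rw [hq] at this
      simp only [map_add, map_smul, add_apply, smul_apply,
        H.conformal x hx, H.normal x hx, hflip hab, hflip had, hbd] at this
      simpa [(H.pos x hx).ne'] using this
    have h2 : inner ℝ q c = 0 := by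
      have := H.bilin_dirDeriv_dirDeriv hx d b c
      rw [hq] at this
      simp only [map_add, map_smul, add_apply, smul_apply,
        H.conformal x hx, H.normal x hx, hbc, hflip hcd, hbd] at this
      simpa [(H.pos x hx).ne'] using this
    rw [H.secondForm_eq hx, H.secondForm_eq hx, hq]
    simp only [map_add, map_smul, add_apply, smul_apply,
      H.bilin_dirDeriv_dirDeriv hx, H.symm (dirDeriv q f x) (N x), H.normal x hx, H.unit x hx,
      hflip h1, hflip h2, hac, smul_eq_mul]
    ring
  -- The pairing of the second derivative along a, c with the derivative along b vanishes
  -- identically on `V`, so it can be differentiated along d. Symmetry of third derivatives in c and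
  -- d then gives the claim.
  have hder {a b c : E} (hab : inner ℝ a b = 0) (hac : inner ℝ a c = 0) (hbc : inner ℝ b c = 0)
      (d : E) : B (dirDeriv d (dirDeriv c (dirDeriv a f)) x) (dirDeriv b f x) +
        B (dirDeriv c (dirDeriv a f) x) (dirDeriv d (dirDeriv b f) x) = 0 := by
    have h1 := dirDeriv_congr H.isOpen
      (g := fun _ => (0 : ℝ)) (f := fun y => B (dirDeriv c (dirDeriv a f) y) (dirDeriv b f y))
      (fun y hy => by
        simp [H.bilin_dirDeriv_dirDeriv hy, hab, hac, hflip hbc]) d hx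
    rwa [dirDeriv_const, dirDeriv_bilin B
      (differentiableAt_of_contDiffOn H.isOpen (contDiffOn_dirDeriv H.isOpen
        (contDiffOn_dirDeriv H.isOpen H.smooth a) c) hx) (H.differentiableAt_dirDeriv hx b)] at h1
  have e1 := hder hab hac hbc d
  have e2 := hder hab had hbd c
  rw [dirDeriv_comm H.isOpen (contDiffOn_dirDeriv H.isOpen H.smooth a) hx c d] at e2
  have p1 := hprod hab hac had hbc hbd hcd
  have p2 := hprod hab had hac hbd hbc (hflip hcd)
  linarith

theorem exists_quasiumbilical [FiniteDimensional ℝ E] [FiniteDimensional ℝ W]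
    (H : IsConformalImmersion B V f ρ N) (hx : x ∈ V)
    (hd : Module.finrank ℝ W = Module.finrank ℝ E + 1) (hE : 4 ≤ Module.finrank ℝ E) :
    ∃ (κ d : ℝ) (u : E), inner ℝ u u = 1 ∧
      ∀ v w, secondForm B f N x v w = κ * inner ℝ v w + d * (inner ℝ u v * inner ℝ u w) :=
  exists_quasiumbilical_form hE _ (H.secondForm_symm hx)
    fun _ _ _ _ => H.gauss_of_orthogonal hx hd

theorem bilin_normal_dirDeriv (H : IsConformalImmersion B V f ρ N) (hx : x ∈ V) (v : E) :
    B (N x) (dirDeriv v N x) = 0 := by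
  have h1 := dirDeriv_congr H.isOpen (fun y hy => H.unit y hy) v hx
  rw [dirDeriv_bilin B (H.differentiableAt_normal hx) (H.differentiableAt_normal hx),
    dirDeriv_const, H.symm (dirDeriv v N x)] at h1
  linarith

/-- Reduces vector identities to pairings with N and with tangent vectors. -/
theorem eq_zero_of_bilin_eq_zero [FiniteDimensional ℝ E] [FiniteDimensional ℝ W]
    (H : IsConformalImmersion B V f ρ N) (hx : x ∈ V)
    (hd : Module.finrank ℝ W = Module.finrank ℝ E + 1) {X : W} (h1 : B (N x) X = 0)
    (h2 : ∀ v, B (dirDeriv v f x) X = 0) : X = 0 := by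
  obtain ⟨q, t, rfl⟩ := H.eq_tangent_add_normal hx hd X
  simp only [map_add, map_smul, H.normal x hx, H.unit x hx, smul_eq_mul] at h1
  have ht : t = 0 := by linarith
  subst ht
  have := h2 q
  simp only [zero_smul, add_zero, H.conformal x hx] at this ⊢
  have hq : q = 0 := by simpa [(H.pos x hx).ne'] using this
  simp [hq, dirDeriv]

/-- The Weingarten formula at a point where the second form is quasiumbilical. -/
theorem dirDeriv_normal_eq [FiniteDimensional ℝ E] [FiniteDimensional ℝ W]
    (H : IsConformalImmersion B V f ρ N) (hx : x ∈ V)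
    (hd : Module.finrank ℝ W = Module.finrank ℝ E + 1) {κ d : ℝ} {u : E}
    (h : ∀ v w, secondForm B f N x v w = κ * inner ℝ v w + d * (inner ℝ u v * inner ℝ u w))
    (w : E) : dirDeriv w N x + (κ / ρ x) • dirDeriv w f x =
      -(d * inner ℝ u w / ρ x) • dirDeriv u f x := by
  have hρ := (H.pos x hx).ne'
  rw [← sub_eq_zero]
  refine H.eq_zero_of_bilin_eq_zero hx hd ?_ fun v => ?_
  · simp [H.normal x hx, H.bilin_normal_dirDeriv hx]
  · have := h v w
    rw [secondForm_apply] at this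
    simp only [map_sub, map_add, map_smul, H.conformal x hx, smul_eq_mul]
    field_simp
    linear_combination -this + d * inner ℝ u w * real_inner_comm u v

/-- A smooth choice of the multiple principal curvature near a point. -/
theorem exists_smooth_principal_curvature [FiniteDimensional ℝ E] [FiniteDimensional ℝ W]
    (H : IsConformalImmersion B V f ρ N) (hx : x ∈ V)
    (hd : Module.finrank ℝ W = Module.finrank ℝ E + 1) (hE : 4 ≤ Module.finrank ℝ E)
    (humb : ∀ y ∈ V, ¬ ∃ c : ℝ, ∀ v, dirDeriv v N y = c • dirDeriv v f y) :
    ∃ V' ⊆ V, IsOpen V' ∧ x ∈ V' ∧ ∃ (l : E → ℝ) (b : E), ContDiffOn ℝ ∞ l V' ∧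
      ∀ y ∈ V', B (dirDeriv b N y + l y • dirDeriv b f y) (dirDeriv b f y) ≠ 0 ∧
        ∀ w, B (dirDeriv b N y + l y • dirDeriv b f y) (dirDeriv b f y) •
            (dirDeriv w N y + l y • dirDeriv w f y) =
          B (dirDeriv b N y + l y • dirDeriv b f y) (dirDeriv w f y) •
            (dirDeriv b N y + l y • dirDeriv b f y) := by
  have hdne {y : E} (hy : y ∈ V) {κ d : ℝ} {u : E}
      (h : ∀ v w, secondForm B f N y v w = κ * inner ℝ v w + d * (inner ℝ u v * inner ℝ u w)) :
      d ≠ 0 := by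
    rintro rfl
    refine humb y hy ⟨-(κ / ρ y), fun v => ?_⟩
    have := H.dirDeriv_normal_eq hy hd h v
    simpa [add_eq_zero_iff_eq_neg] using this
  obtain ⟨κ₀, d₀, u₀, hu₀, h₀⟩ := H.exists_quasiumbilical hx hd hE
  obtain ⟨a, b, c, hab, hac, hbc, hua, hub, huc⟩ := exists_orthogonal_triple (by omega) hu₀
  have hd₀ := hdne hx h₀
  have hcont (v w : E) : ContinuousAt (fun y => secondForm B f N y v w) x :=
    (H.contDiffOn_secondForm v w).continuousOn.continuousAt (H.isOpen.mem_nhds hx)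
  have hev : ∀ᶠ y in 𝓝 x, y ∈ V ∧ secondForm B f N y a b ≠ 0 ∧ secondForm B f N y b c ≠ 0 := by
    refine (H.isOpen.eventually_mem hx).and (((hcont a b).eventually_ne ?_).and
      ((hcont b c).eventually_ne ?_)) <;> simp [h₀, hab, hbc, hua, hub, huc, hd₀]
  obtain ⟨V', hV', hV'o, hxV'⟩ := eventually_nhds_iff.1 hev
  have hsub : V' ⊆ V := fun y hy => (hV' y hy).1
  have ha : inner ℝ a a ≠ (0 : ℝ) := by
    intro h
    rw [inner_self_eq_zero] at h
    simp [h] at hua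
  -- The directions a, b, c are fixed at `x`. Since h(a,b)h(a,c)/h(b,c) = d⟨u,a⟩², the formula gives
  -- κ/ρ at every nearby point, and it is smooth although κ, d and u are chosen pointwise.
  refine ⟨V', hsub, hV'o, hxV', fun y => (secondForm B f N y a a - secondForm B f N y a b *
    secondForm B f N y a c / secondForm B f N y b c) / inner ℝ a a / ρ y, b, ?_, fun y hy => ?_⟩
  · have hs (v w : E) := (H.contDiffOn_secondForm v w).mono hsub
    exact (((hs a a).sub (((hs a b).mul (hs a c)).div (hs b c) fun y hy => (hV' y hy).2.2)).div_const
      _).div (H.smooth_factor.mono hsub) fun y hy => (H.pos y (hsub hy)).ne'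
  · obtain ⟨hyV, h1, h2⟩ := hV' y hy
    obtain ⟨κ, d, u, hu, h⟩ := H.exists_quasiumbilical hyV hd hE
    have hρ := (H.pos y hyV).ne'
    have hκ : (secondForm B f N y a a - secondForm B f N y a b *
        secondForm B f N y a c / secondForm B f N y b c) / inner ℝ a a = κ := by
      simp only [h, hab, hac, hbc, mul_zero, zero_add] at h1 h2 ⊢
      have hd1 : d ≠ 0 := left_ne_zero_of_mul h1
      have hb1 : inner ℝ u b ≠ (0 : ℝ) := right_ne_zero_of_mul (right_ne_zero_of_mul h1)
      have hc1 : inner ℝ u c ≠ (0 : ℝ) := right_ne_zero_of_mul (right_ne_zero_of_mul h2)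
      field_simp
      ring
    have hub' : d * inner ℝ u b ≠ 0 := by
      rw [h, hab, mul_zero, zero_add, mul_left_comm] at h1
      exact right_ne_zero_of_mul h1
    simp only [hκ, H.dirDeriv_normal_eq hyV hd h, map_smul, smul_apply,
      H.conformal y hyV, smul_smul, smul_eq_mul]
    refine ⟨?_, fun w => ?_⟩
    · have : -(d * inner ℝ u b / ρ y) * (ρ y * inner ℝ u b) = -(d * inner ℝ u b * inner ℝ u b) := by
        field_simp
      rw [this]
      exact neg_ne_zero.2 (mul_ne_zero hub' (right_ne_zero_of_mul hub'))
    · congr 1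
      field_simp

/-- Codazzi: the multiple principal curvature is constant along its principal distribution. -/
theorem dirDeriv_principal_curvature_eq_zero [FiniteDimensional ℝ E]
    (H : IsConformalImmersion B V f ρ N) (hx : x ∈ V) (hE : 3 ≤ Module.finrank ℝ E)
    {l m : E → ℝ} {Y : E → W} {θ : E → E → ℝ} (hl : ContDiffOn ℝ ∞ l V)
    (hm : ContDiffOn ℝ ∞ m V) (hY : ContDiffOn ℝ ∞ Y V)
    (hθ : ∀ y, ∀ w, θ w y = B (Y y) (dirDeriv w f y)) (hm0 : m x ≠ 0)
    (h : ∀ y ∈ V, ∀ w, m y • (dirDeriv w N y + l y • dirDeriv w f y) = θ w y • Y y)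
    {w : E} (hw : θ w x = 0) : dirDeriv w l x = 0 := by
  -- A second principal direction orthogonal to `w`; this is why dimension three is required.
  obtain ⟨v, hv0, hv, hvw⟩ := exists_ne_zero_of_two_functionals hE
    ((B (Y x)).comp (fderiv ℝ f x) : E →L[ℝ] ℝ).toLinearMap (innerₛₗ ℝ w)
  replace hv : θ v x = 0 := by rw [hθ]; exact hv
  replace hvw : inner ℝ w v = 0 := by simpa using hvw
  have hθd (w : E) : DifferentiableAt ℝ (θ w) x := by
    have : θ w = fun y => B (Y y) (dirDeriv w f y) := funext fun y => hθ y w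
    rw [this]
    exact differentiableAt_of_contDiffOn H.isOpen
      (contDiffOn_bilin B hY (contDiffOn_dirDeriv H.isOpen H.smooth w)) hx
  have hNd (w : E) : DifferentiableAt ℝ (dirDeriv w N) x := differentiableAt_of_contDiffOn H.isOpen
    (contDiffOn_dirDeriv H.isOpen H.smooth_normal w) hx
  have hld := differentiableAt_of_contDiffOn H.isOpen hl hx
  have hmd := differentiableAt_of_contDiffOn H.isOpen hm hx
  have hYd := differentiableAt_of_contDiffOn H.isOpen hY hx
  have hfd := H.differentiableAt_dirDeriv hx
  have key {v w : E} (hw : θ w x = 0) :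
      m x • (dirDeriv v (dirDeriv w N) x + l x • dirDeriv v (dirDeriv w f) x
        + dirDeriv v l x • dirDeriv w f x) = dirDeriv v (θ w) x • Y x := by
    have h0 : dirDeriv w N x + l x • dirDeriv w f x = 0 := by
      have := h x hx w
      rw [hw, zero_smul] at this
      exact (smul_eq_zero.1 this).resolve_left hm0
    have h1 := dirDeriv_congr H.isOpen (fun y hy => h y hy w) v hx
    have hsd : DifferentiableAt ℝ (fun y => l y • dirDeriv w f y) x := hld.smul (hfd w)
    rw [dirDeriv_smul hmd ((hNd w).fun_add hsd), dirDeriv_smul (hθd w) hYd,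
      dirDeriv_add (hNd w) hsd, dirDeriv_smul hld (hfd w), h0, hw, smul_zero, zero_smul, add_zero,
      zero_add, ← add_assoc] at h1
    exact h1
  have k1 := key (v := v) hw
  have k2 := key (v := w) hv
  -- With the second derivatives made equal, pairing with the derivative of f along `v` kills both
  -- multiples of `Y`, because `θ v x = 0`, and the term containing ⟨w,v⟩. Only the derivative of
  -- `l` along `w` survives the subtraction.
  rw [dirDeriv_comm H.isOpen H.smooth hx, dirDeriv_comm H.isOpen H.smooth_normal hx] at k2
  have k3 := congrArg (fun X => B X (dirDeriv v f x)) k1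
  have k4 := congrArg (fun X => B X (dirDeriv v f x)) k2
  simp only [map_add, map_smul, add_apply, smul_apply,
    smul_eq_mul, ← hθ, hv, H.conformal x hx, hvw, mul_zero] at k3 k4
  have : m x * (dirDeriv w l x * (ρ x * inner ℝ v v)) = 0 := by linear_combination k4 - k3
  simpa [hm0, (H.pos x hx).ne', hv0] using this

end IsConformalImmersion

end Hypersurface

/-! ### Smooth factorisation through a submersion to the line. -/

section Factor

variable {E G : Type*} [NormedAddCommGroup E] [InnerProductSpace ℝ E] [FiniteDimensional ℝ E]
  [NormedAddCommGroup G] [NormedSpace ℝ G]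

/-- The map replaces the b-coordinate of w by φ w, which is invertible because φ b ≠ 0. It is the
differential of the straightening map in `exists_factor_of_ker_le`. -/
theorem exists_equiv_shear {b : E} (hb : inner ℝ b b = 1) (φ : E →L[ℝ] ℝ) (hφ : φ b ≠ 0) :
    ∃ T : E ≃L[ℝ] E, (T : E →L[ℝ] E) =
      ContinuousLinearMap.id ℝ E + (φ - innerSL ℝ b).smulRight b := by
  set L : E →L[ℝ] E := ContinuousLinearMap.id ℝ E + (φ - innerSL ℝ b).smulRight b with hL
  have hLa (w : E) : L w = w + (φ w - inner ℝ b w) • b := by simp [hL]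
  have hinj : Function.Injective (L : E →ₗ[ℝ] E) := by
    refine (injective_iff_map_eq_zero _).2 fun w hw => ?_
    replace hw : w + (φ w - inner ℝ b w) • b = 0 := by rw [← hLa]; exact hw
    have h1 : φ w = 0 := by
      have := congrArg (inner ℝ b) hw
      simp only [inner_add_right, real_inner_smul_right, hb, inner_zero_right] at this
      linarith
    have h2 : w = inner ℝ b w • b := by
      rw [h1, zero_sub, neg_smul, add_neg_eq_zero] at hw
      exact hw
    rw [h2, map_smul, smul_eq_mul] at h1
    rw [h2, (mul_eq_zero.1 h1).resolve_right hφ, zero_smul]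
  refine ⟨(LinearEquiv.ofInjectiveEndo (L : E →ₗ[ℝ] E) hinj).toContinuousLinearEquiv, ?_⟩
  ext w
  rfl

/-- A smooth map that is infinitesimally constant along the level sets of a submersion `s` to the
line is locally a smooth function of `s`. -/
theorem exists_factor_of_ker_le {V : Set E} (hV : IsOpen V) {s : E → ℝ} {g : E → G}
    (hs : ContDiffOn ℝ ∞ s V) (hg : ContDiffOn ℝ ∞ g V) {x₀ : E} (hx₀ : x₀ ∈ V)
    (hds : fderiv ℝ s x₀ ≠ 0)
    (hker : ∀ x ∈ V, ∀ w, dirDeriv w s x = 0 → dirDeriv w g x = 0) :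
    ∃ U ⊆ V, IsOpen U ∧ x₀ ∈ U ∧ ∃ J : Set ℝ, IsOpen J ∧ J.OrdConnected ∧ s '' U = J ∧
      ∃ γ : ℝ → G, ContDiffOn ℝ ∞ γ J ∧ ∀ x ∈ U, g x = γ (s x) := by
  obtain ⟨b, hb, hsb⟩ : ∃ b : E, inner ℝ b b = (1 : ℝ) ∧ dirDeriv b s x₀ ≠ 0 := by
    obtain ⟨w, hw⟩ : ∃ w, fderiv ℝ s x₀ w ≠ 0 := by
      by_contra! hc
      exact hds (ContinuousLinearMap.ext hc)
    have hw0 : w ≠ 0 := by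
      rintro rfl
      exact hw (map_zero _)
    refine ⟨‖w‖⁻¹ • w, ?_, ?_⟩
    · rw [real_inner_smul_left, real_inner_smul_right, real_inner_self_eq_norm_sq]
      field_simp [norm_ne_zero_iff.2 hw0]
    · simp [dirDeriv, hw, hw0]
  have hbn : ‖b‖ = 1 := by
    rw [real_inner_self_eq_norm_sq] at hb
    exact (pow_eq_one_iff_of_nonneg (norm_nonneg b) two_ne_zero).1 hb
  have hsbc : ContinuousAt (dirDeriv b s) x₀ :=
    (contDiffOn_dirDeriv hV hs b).continuousOn.continuousAt (hV.mem_nhds hx₀)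
  obtain ⟨V₁, hV₁, hV₁o, hxV₁⟩ :=
    eventually_nhds_iff.1 ((hV.eventually_mem hx₀).and (hsbc.eventually_ne hsb))
  -- Straightens the level sets of `s` into hyperplanes orthogonal to `b`.
  let Φ : E → E := fun x => x + (s x - inner ℝ b x) • b
  have hbΦ (x : E) : inner ℝ b (Φ x) = s x := by
    simp [Φ, inner_add_right, real_inner_smul_right, hbn]
  have hΦs (x : E) (hx : x ∈ V₁) : ContDiffAt ℝ ∞ Φ x :=
    contDiffAt_id.add (((hs.contDiffAt (hV.mem_nhds (hV₁ x hx).1)).sub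
      (contDiffAt_const.inner ℝ contDiffAt_id)).smul contDiffAt_const)
  have hΦd (x : E) (hx : x ∈ V₁) : ∃ T : E ≃L[ℝ] E, HasFDerivAt Φ (T : E →L[ℝ] E) x := by
    obtain ⟨T, hT⟩ := exists_equiv_shear hb (fderiv ℝ s x) (hV₁ x hx).2
    refine ⟨T, hT ▸ ?_⟩
    exact (hasFDerivAt_id x).add (((differentiableAt_of_contDiffOn hV hs
      (hV₁ x hx).1).hasFDerivAt.sub (innerSL ℝ b).hasFDerivAt).smul_const b)
  obtain ⟨T₀, hT₀⟩ := hΦd x₀ hxV₁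
  let e := (hΦs x₀ hxV₁).toOpenPartialHomeomorph Φ hT₀ (by simp)
  have heΦ (x : E) : e x = Φ x := rfl
  have hxe : x₀ ∈ e.source := (hΦs x₀ hxV₁).mem_toOpenPartialHomeomorph_source hT₀ (by simp)
  -- A ball is convex, so its slices orthogonal to `b` are connected by segments. On each segment
  -- `g` is constant, and `g` is determined by its values along `line`.
  obtain ⟨r, hr, hball⟩ : ∃ r > 0, Metric.ball (Φ x₀) r ⊆ e.target ∩ e.symm ⁻¹' V₁ := by
    refine Metric.isOpen_iff.1 (e.isOpen_inter_preimage_symm hV₁o) _ ⟨e.map_source hxe, ?_⟩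
    change e.symm (e x₀) ∈ V₁
    rwa [e.left_inv hxe]
  have hsymm {y : E} (hy : y ∈ Metric.ball (Φ x₀) r) : ContDiffAt ℝ ∞ e.symm y := by
    obtain ⟨T, hT⟩ := hΦd _ (hball hy).2
    exact e.contDiffAt_symm (hball hy).1 hT (hΦs _ (hball hy).2)
  have hssymm {y : E} (hy : y ∈ Metric.ball (Φ x₀) r) : s (e.symm y) = inner ℝ b y := by
    rw [← hbΦ, ← heΦ, e.right_inv (hball hy).1]
  let line : ℝ → E := fun t => Φ x₀ + (t - s x₀) • b
  have hline {t : ℝ} (ht : |t - s x₀| < r) : line t ∈ Metric.ball (Φ x₀) r := by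
    simpa [line, norm_smul, hbn] using ht
  have hbline (t : ℝ) : inner ℝ b (line t) = t := by
    simp [line, inner_add_right, real_inner_smul_right, hbn, hbΦ]
  have habs {y : E} (hy : y ∈ Metric.ball (Φ x₀) r) : |inner ℝ b y - s x₀| < r := by
    rw [← hbΦ x₀, ← inner_sub_right]
    calc |inner ℝ b (y - Φ x₀)| ≤ ‖b‖ * ‖y - Φ x₀‖ := abs_real_inner_le_norm _ _
      _ < r := by rw [hbn, one_mul]; exact mem_ball_iff_norm.1 hy
  have hconst {y : E} (hy : y ∈ Metric.ball (Φ x₀) r) :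
      g (e.symm y) = g (e.symm (line (inner ℝ b y))) := by
    set y' := line (inner ℝ b y) with hy'
    have hy'm : y' ∈ Metric.ball (Φ x₀) r := hline (habs hy)
    let c : ℝ → E := fun t => y' + t • (y - y')
    have hc (t : ℝ) (ht : t ∈ Set.Icc (0 : ℝ) 1) : c t ∈ Metric.ball (Φ x₀) r :=
      (convex_ball _ _).add_smul_sub_mem hy'm hy ht
    have hcd (t : ℝ) : HasDerivAt c (y - y') t := by
      have := ((hasDerivAt_id t).smul_const (y - y')).const_add y'
      rwa [one_smul] at this
    have hbc (t : ℝ) : inner ℝ b (c t) = inner ℝ b y := by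
      simp [c, inner_add_right, inner_sub_right, real_inner_smul_right, hy', hbline]
    have hder (t : ℝ) (ht : t ∈ Set.Icc (0 : ℝ) 1) :
        HasDerivAt (fun t => g (e.symm (c t))) 0 t := by
      have h1 : HasDerivAt (fun t => e.symm (c t)) (fderiv ℝ e.symm (c t) (y - y')) t :=
        ((hsymm (hc t ht)).differentiableAt (by simp)).hasFDerivAt.comp_hasDerivAt t (hcd t)
      have hmem : e.symm (c t) ∈ V := (hV₁ _ (hball (hc t ht)).2).1
      have h2 := (differentiableAt_of_contDiffOn hV hg hmem).hasFDerivAt.comp_hasDerivAt t h1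
      have h3 := (differentiableAt_of_contDiffOn hV hs hmem).hasFDerivAt.comp_hasDerivAt t h1
      have h4 : (fun t => s (e.symm (c t))) =ᶠ[𝓝 t] fun _ => inner ℝ b y := by
        filter_upwards [(hcd t).continuousAt.preimage_mem_nhds
          (Metric.isOpen_ball.mem_nhds (hc t ht))] with t' ht'
        rw [hssymm ht', hbc]
      have h5 := hker _ hmem (fderiv ℝ e.symm (c t) (y - y'))
        (h3.unique ((hasDerivAt_const t _).congr_of_eventuallyEq h4))
      exact h5 ▸ h2
    have := constant_of_has_deriv_right_zero
      (fun t ht => (hder t ht).continuousAt.continuousWithinAt)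
      (fun t ht => (hder t (Set.Ico_subset_Icc_self ht)).hasDerivWithinAt) 1 (by simp)
    simpa [c] using this
  have hUV {x : E} (hx : x ∈ e.source ∩ e ⁻¹' Metric.ball (Φ x₀) r) : x ∈ V₁ := by
    have := (hball hx.2).2
    rwa [Set.mem_preimage, e.left_inv hx.1] at this
  refine ⟨e.source ∩ e ⁻¹' Metric.ball (Φ x₀) r, fun x hx => (hV₁ x (hUV hx)).1,
    e.isOpen_inter_preimage Metric.isOpen_ball, ⟨hxe, Metric.mem_ball_self hr⟩,
    Metric.ball (s x₀) r, Metric.isOpen_ball, (convex_ball _ _).ordConnected, ?_,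
    fun t => g (e.symm (line t)), fun t ht => ?_, fun x hx => ?_⟩
  · ext t
    constructor
    · rintro ⟨x, hx, rfl⟩
      have := habs hx.2
      rwa [heΦ, hbΦ] at this
    · intro ht
      have hm := hline ht
      refine ⟨e.symm (line t), ⟨e.map_target (hball hm).1, ?_⟩, by rw [hssymm hm, hbline]⟩
      rwa [Set.mem_preimage, e.right_inv (hball hm).1]
  · have hm := hline ht
    have hl : ContDiffAt ℝ ∞ line t :=
      contDiffAt_const.add ((contDiffAt_id.sub contDiffAt_const).smul contDiffAt_const)
    have hg' : ContDiffAt ℝ ∞ g (e.symm (line t)) :=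
      hg.contDiffAt (hV.mem_nhds (hV₁ _ (hball hm).2).1)
    exact (hg'.comp t ((hsymm hm).comp t hl)).contDiffWithinAt
  · have := hconst hx.2
    rwa [e.left_inv hx.1, heΦ, hbΦ] at this

end Factor

/-! ### The focal curve and the canal structure in a chart. -/

section Canal

variable {E W : Type*} [NormedAddCommGroup E] [InnerProductSpace ℝ E] [FiniteDimensional ℝ E]
  [NormedAddCommGroup W] [NormedSpace ℝ W] [FiniteDimensional ℝ W]
  {B : W →L[ℝ] W →L[ℝ] ℝ} {V : Set E} {f N : E → W} {ρ : E → ℝ} {x : E}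

theorem IsConformalImmersion.exists_canal (H : IsConformalImmersion B V f ρ N) (hx : x ∈ V)
    (hd : Module.finrank ℝ W = Module.finrank ℝ E + 1) (hE : 4 ≤ Module.finrank ℝ E)
    (humb : ∀ y ∈ V, ¬ ∃ c : ℝ, ∀ v, dirDeriv v N y = c • dirDeriv v f y)
    (hrank : ¬ ∃ X : W, ∀ v, ∃ c : ℝ, dirDeriv v N x = c • X) :
    ∃ U ⊆ V, IsOpen U ∧ x ∈ U ∧ ∃ (J : Set ℝ) (s : E → ℝ) (z : ℝ → W) (R : ℝ → ℝ) (v : ℝ → W)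
      (c : ℝ → ℝ), IsOpen J ∧ J.OrdConnected ∧ s '' U = J ∧ ContDiffOn ℝ ∞ s U ∧
        (∀ y ∈ U, fderiv ℝ s y ≠ 0) ∧
        ContDiffOn ℝ ∞ z J ∧ ContDiffOn ℝ ∞ R J ∧ ContDiffOn ℝ ∞ v J ∧ ContDiffOn ℝ ∞ c J ∧
        (∀ t ∈ J, 0 < R t ∧ v t ≠ 0) ∧
        ∀ y ∈ U, B (f y - z (s y)) (f y - z (s y)) = -R (s y) ^ 2 ∧
          B (f y) (v (s y)) = c (s y) ∧ ∀ w, B (f y - z (s y)) (dirDeriv w f y) = 0 := by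
  obtain ⟨V₁, hV₁V, hV₁, hxV₁, l, b, hl, hlb⟩ :=
    H.exists_smooth_principal_curvature hx hd hE humb
  -- If `l x` were zero, dN itself would take values in a line, against `hrank`.
  have hlx : l x ≠ 0 := by
    intro h0
    obtain ⟨h1, h2⟩ := hlb x hxV₁
    refine hrank ⟨dirDeriv b N x, fun w => ?_⟩
    simp only [h0, zero_smul, add_zero] at h1 h2
    exact ⟨(B (dirDeriv b N x) (dirDeriv b f x))⁻¹ * B (dirDeriv b N x) (dirDeriv w f x), by
      rw [mul_smul, ← h2 w, inv_smul_smul₀ h1]⟩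
  have hlc : ContinuousAt l x := hl.continuousOn.continuousAt (hV₁.mem_nhds hxV₁)
  obtain ⟨V₂, hV₂', hV₂, hxV₂⟩ :=
    eventually_nhds_iff.1 ((hV₁.eventually_mem hxV₁).and (hlc.eventually_ne hlx))
  replace hl : ContDiffOn ℝ ∞ l V₂ := hl.mono fun y hy => (hV₂' y hy).1
  replace H := H.mono hV₂ fun y hy => hV₁V (hV₂' y hy).1
  have hl0 (y : E) (hy : y ∈ V₂) : l y ≠ 0 := (hV₂' y hy).2
  let Y : E → W := fun y => dirDeriv b N y + l y • dirDeriv b f y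
  let θ : E → E → ℝ := fun w y => B (Y y) (dirDeriv w f y)
  have hY : ContDiffOn ℝ ∞ Y V₂ := (contDiffOn_dirDeriv H.isOpen H.smooth_normal b).add
    (hl.smul (contDiffOn_dirDeriv H.isOpen H.smooth b))
  have hm0 (y : E) (hy : y ∈ V₂) : θ b y ≠ 0 := (hlb y (hV₂' y hy).1).1
  have hθ (y : E) (hy : y ∈ V₂) (w : E) :
      θ b y • (dirDeriv w N y + l y • dirDeriv w f y) = θ w y • Y y :=
    (hlb y (hV₂' y hy).1).2 w
  have hlw (y : E) (hy : y ∈ V₂) (w : E) (hw : θ w y = 0) : dirDeriv w l y = 0 :=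
    H.dirDeriv_principal_curvature_eq_zero hy (by omega) hl
      (contDiffOn_bilin B hY (contDiffOn_dirDeriv H.isOpen H.smooth b)) hY (fun _ _ => rfl)
      (hm0 y hy) hθ hw
  let k : E → ℝ := fun y => (l y)⁻¹
  have hk : ContDiffOn ℝ ∞ k V₂ := hl.inv hl0
  have hkd {y : E} (hy : y ∈ V₂) : DifferentiableAt ℝ k y := differentiableAt_of_contDiffOn hV₂ hk hy
  have hkw (y : E) (hy : y ∈ V₂) (w : E) (hw : θ w y = 0) : dirDeriv w k y = 0 := by
    have h1 := dirDeriv_congr hV₂ (f := fun y => l y • k y) (g := fun _ => (1 : ℝ))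
      (fun y hy => mul_inv_cancel₀ (hl0 y hy)) w hy
    rw [dirDeriv_smul (differentiableAt_of_contDiffOn hV₂ hl hy) (hkd hy), dirDeriv_const,
      hlw y hy w hw, zero_smul, add_zero] at h1
    exact (smul_eq_zero.1 h1).resolve_left (hl0 y hy)
  -- The focal point, which becomes the centre of the generating sphere.
  let ζ : E → W := fun y => f y + k y • N y
  have hζ : ContDiffOn ℝ ∞ ζ V₂ := H.smooth.add (hk.smul H.smooth_normal)
  have hζd (y : E) (hy : y ∈ V₂) (w : E) : dirDeriv w ζ y =
      k y • (dirDeriv w N y + l y • dirDeriv w f y) + dirDeriv w k y • N y := by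
    have h1 : DifferentiableAt ℝ (fun y => k y • N y) y := (hkd hy).smul (H.differentiableAt_normal hy)
    rw [dirDeriv_add (H.differentiableAt hy) h1, dirDeriv_smul (hkd hy) (H.differentiableAt_normal hy),
      smul_add, smul_smul, show k y * l y = 1 from inv_mul_cancel₀ (hl0 y hy), one_smul]
    abel
  have hζw (y : E) (hy : y ∈ V₂) (w : E) (hw : θ w y = 0) : dirDeriv w ζ y = 0 := by
    have h1 := hθ y hy w
    rw [hw, zero_smul] at h1
    rw [hζd y hy, hkw y hy w hw, (smul_eq_zero.1 h1).resolve_left (hm0 y hy), smul_zero, zero_smul,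
      add_zero]
  have hζb (y : E) (hy : y ∈ V₂) : B (dirDeriv b ζ y) (dirDeriv b f y) ≠ 0 := by
    rw [hζd y hy]
    simp only [map_add B, map_smul B, add_apply, smul_apply, H.normal y hy, smul_zero, add_zero]
    have : B (dirDeriv b N y) (dirDeriv b f y) + l y • B (dirDeriv b f y) (dirDeriv b f y) =
      θ b y := by simp [θ, Y]
    rw [this]
    exact smul_ne_zero (inv_ne_zero (hl0 y hy)) (hm0 y hy)
  -- A fixed functional not vanishing on the derivative of ζ along `b` at `x`; composed with ζ it
  -- gives a submersion near `x`.
  let ℓ : W →L[ℝ] ℝ := B (dirDeriv b f x)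
  let s : E → ℝ := fun y => ℓ (ζ y)
  have hs : ContDiffOn ℝ ∞ s V₂ := ℓ.contDiff.comp_contDiffOn hζ
  have hsw (y : E) (hy : y ∈ V₂) (w : E) : dirDeriv w s y = ℓ (dirDeriv w ζ y) := by
    have := (ℓ.hasFDerivAt.comp y (differentiableAt_of_contDiffOn hV₂ hζ hy).hasFDerivAt).fderiv
    unfold dirDeriv
    rw [show s = ℓ ∘ ζ from rfl, this]
    rfl
  have hsbx : dirDeriv b s x ≠ 0 := by
    rw [hsw x hxV₂, show ℓ (dirDeriv b ζ x) = B (dirDeriv b ζ x) (dirDeriv b f x) from H.symm _ _]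
    exact hζb x hxV₂
  have hsbc : ContinuousAt (dirDeriv b s) x :=
    (contDiffOn_dirDeriv hV₂ hs b).continuousOn.continuousAt (hV₂.mem_nhds hxV₂)
  obtain ⟨V₃, hV₃', hV₃, hxV₃⟩ :=
    eventually_nhds_iff.1 ((hV₂.eventually_mem hxV₂).and (hsbc.eventually_ne hsbx))
  have hV₃₂ : V₃ ⊆ V₂ := fun y hy => (hV₃' y hy).1
  -- Subtract from `w` the multiple of `b` that brings it into the kernel of θ, where ds vanishes.
  -- Since ds is nonzero on `b`, that multiple must be zero.
  have hθw (y : E) (hy : y ∈ V₃) (w : E) (hw : dirDeriv w s y = 0) : θ w y = 0 := by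
    have h1 : θ (w - (θ w y / θ b y) • b) y = 0 := by
      have : θ (w - (θ w y / θ b y) • b) y = θ w y - (θ w y / θ b y) * θ b y := by
        simp [θ, dirDeriv]
      rw [this, div_mul_cancel₀ _ (hm0 y (hV₃₂ hy)), sub_self]
    have h2 := hsw y (hV₃₂ hy) (w - (θ w y / θ b y) • b)
    rw [hζw y (hV₃₂ hy) _ h1, map_zero] at h2
    have h3 : dirDeriv (w - (θ w y / θ b y) • b) s y =
      dirDeriv w s y - (θ w y / θ b y) * dirDeriv b s y := by simp [dirDeriv]
    rw [h3, hw, zero_sub, neg_eq_zero] at h2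
    have h4 := (mul_eq_zero.1 h2).resolve_right (hV₃' y hy).2
    exact (div_eq_zero_iff.1 h4).resolve_right (hm0 y (hV₃₂ hy))
  obtain ⟨U, hUV, hU, hxU, J, hJ, hJc, hsU, γ, hγ, hγs⟩ :=
    exists_factor_of_ker_le (g := fun y => (ζ y, k y)) hV₃ (hs.mono hV₃₂)
      ((hζ.prodMk hk).mono hV₃₂) hxV₃ (fun h => hsbx (by simp [dirDeriv, h])) fun y hy w hw => by
        have h1 := hθw y hy w hw
        have h2 := (differentiableAt_of_contDiffOn hV₂ hζ (hV₃₂ hy)).fderiv_prodMk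
          (hkd (hV₃₂ hy))
        unfold dirDeriv
        rw [h2]
        exact Prod.ext (hζw y (hV₃₂ hy) w h1) (hkw y (hV₃₂ hy) w h1)
  have hζγ (y : E) (hy : y ∈ U) : ζ y = (γ (s y)).1 := congrArg Prod.fst (hγs y hy)
  have hkγ (y : E) (hy : y ∈ U) : k y = (γ (s y)).2 := congrArg Prod.snd (hγs y hy)
  have hγ₁ : ContDiffOn ℝ ∞ (fun t => (γ t).1) J := hγ.fst
  have hγ₂ : ContDiffOn ℝ ∞ (fun t => (γ t).2) J := hγ.snd
  have hsJ (y : E) (hy : y ∈ U) : s y ∈ J := hsU ▸ Set.mem_image_of_mem s hy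
  have hU₂ (y : E) (hy : y ∈ U) : y ∈ V₂ := hV₃₂ (hUV hy)
  have hsd (y : E) (hy : y ∈ U) : DifferentiableAt ℝ s y :=
    differentiableAt_of_contDiffOn hV₂ hs (hU₂ y hy)
  have hζb' (y : E) (hy : y ∈ U) :
      dirDeriv b ζ y = dirDeriv b s y • deriv (fun t => (γ t).1) (s y) := by
    rw [dirDeriv_congr hU hζγ b hy]
    exact dirDeriv_comp_real (differentiableAt_of_contDiffOn hJ hγ₁ (hsJ y hy)) (hsd y hy) b
  have hkb' (y : E) (hy : y ∈ U) :
      dirDeriv b k y = dirDeriv b s y • deriv (fun t => (γ t).2) (s y) := by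
    rw [dirDeriv_congr hU hkγ b hy]
    exact dirDeriv_comp_real (differentiableAt_of_contDiffOn hJ hγ₂ (hsJ y hy)) (hsd y hy) b
  have hγ₂0 (t : ℝ) (ht : t ∈ J) : (γ t).2 ≠ 0 := by
    rw [← hsU] at ht
    obtain ⟨y, hy, rfl⟩ := ht
    rw [← hkγ y hy]
    exact inv_ne_zero (hl0 y (hU₂ y hy))
  have hv : ContDiffOn ℝ ∞ (deriv fun t => (γ t).1) J := hγ₁.deriv_of_isOpen hJ (by simp)
  refine ⟨U, fun y hy => hV₁V (hV₂' y (hU₂ y hy)).1, hU, hxU, J, s, fun t => (γ t).1,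
    -- The radius is the absolute value of k, which may be negative, written as a root of a
    -- nonvanishing square so that it is visibly smooth. The constant c = ⟨z,z'⟩ + kk' comes from
    -- differentiating ⟨f - z, f - z⟩ = -k² in the parameter with f held fixed.
    fun t => √((γ t).2 ^ 2), deriv fun t => (γ t).1,
    fun t => B (γ t).1 (deriv (fun t => (γ t).1) t) + (γ t).2 * deriv (fun t => (γ t).2) t,
    hJ, hJc, hsU, hs.mono hU₂, fun y hy h0 => (hV₃' y (hUV hy)).2 (by simp [dirDeriv, h0]), hγ₁,
    (hγ₂.pow 2).sqrt fun t ht => pow_ne_zero 2 (hγ₂0 t ht), hv,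
    (contDiffOn_bilin B hγ₁ hv).add (hγ₂.mul (hγ₂.deriv_of_isOpen hJ (by simp))),
    fun t ht => ⟨?_, ?_⟩, fun y hy => ?_⟩
  · exact Real.sqrt_pos.2 (sq_pos_of_ne_zero (hγ₂0 t ht))
  · rw [← hsU] at ht
    obtain ⟨y, hy, rfl⟩ := ht
    intro h0
    refine hζb y (hU₂ y hy) ?_
    rw [hζb' y hy, h0, smul_zero, map_zero, zero_apply]
  · have hfz : f y - (γ (s y)).1 = -(k y • N y) := by
      rw [← hζγ y hy]
      simp [ζ]
    have hy₂ := hU₂ y hy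
    refine ⟨?_, ?_, fun w => ?_⟩
    · rw [hfz, Real.sq_sqrt (sq_nonneg _), ← hkγ y hy]
      simp [H.unit y hy₂]
      ring
    · have h1 : B (f y - (γ (s y)).1) (dirDeriv b ζ y) = k y * dirDeriv b k y := by
        rw [hfz, hζd y hy₂]
        simp [H.unit y hy₂, H.normal y hy₂, H.bilin_normal_dirDeriv hy₂]
      rw [hζb' y hy, hkb' y hy, map_smul, smul_eq_mul, smul_eq_mul, mul_left_comm, hkγ y hy] at h1
      have h2 := mul_left_cancel₀ (hV₃' y (hUV hy)).2 h1
      rw [map_sub, sub_apply] at h2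
      linarith
    · rw [hfz]
      simp [H.normal y hy₂]

end Canal

/-! ### Unit normal fields: local existence and dependence on one value. -/

section Normal

variable {E W : Type*} [NormedAddCommGroup E] [InnerProductSpace ℝ E] [FiniteDimensional ℝ E]
  [NormedAddCommGroup W] [NormedSpace ℝ W]
  {B : W →L[ℝ] W →L[ℝ] ℝ} {V : Set E} {f N : E → W} {ρ : E → ℝ} {x : E}

/-- A unit time-like normal vector at a point extends to a smooth unit normal field nearby. -/
theorem exists_isConformalImmersion (hB : ∀ X Y, B X Y = B Y X) (hV : IsOpen V)
    (hf : ContDiffOn ℝ ∞ f V) (hρ : ContDiffOn ℝ ∞ ρ V) (hρ0 : ∀ y ∈ V, 0 < ρ y)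
    (hc : ∀ y ∈ V, ∀ v w : E, B (dirDeriv v f y) (dirDeriv w f y) = ρ y * inner ℝ v w)
    (hx : x ∈ V) {n₀ : W} (hn₀ : B n₀ n₀ = -1) (hn₀f : ∀ w, B n₀ (dirDeriv w f x) = 0) :
    ∃ V' ⊆ V, x ∈ V' ∧ ∃ N : E → W, N x = n₀ ∧ IsConformalImmersion B V' f ρ N := by
  let e := stdOrthonormalBasis ℝ E
  -- Projection of the constant vector `n₀` off the tangent space: by conformality the images of an
  -- orthonormal basis are orthogonal of square ρ.
  let P : E → W := fun y => n₀ - ∑ i, (B n₀ (dirDeriv (e i) f y) / ρ y) • dirDeriv (e i) f y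
  have hP : ContDiffOn ℝ ∞ P V := contDiffOn_const.sub <| ContDiffOn.sum fun i _ =>
    ((contDiffOn_bilin B contDiffOn_const (contDiffOn_dirDeriv hV hf (e i))).div hρ
      fun y hy => (hρ0 y hy).ne').smul (contDiffOn_dirDeriv hV hf (e i))
  have hPx : P x = n₀ := by simp [P, hn₀f]
  have hPf (y : E) (hy : y ∈ V) (w : E) : B (P y) (dirDeriv w f y) = 0 := by
    have h1 : dirDeriv w f y = ∑ i, inner ℝ (e i) w • dirDeriv (e i) f y := by
      conv_lhs => rw [← e.sum_repr' w]
      simp [dirDeriv]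
    have h2 : B n₀ (dirDeriv w f y) = ∑ i, inner ℝ (e i) w * B n₀ (dirDeriv (e i) f y) := by
      rw [h1]
      simp
    simp only [P, map_sub, map_sum, map_smul, sub_apply, sum_apply, smul_apply, hc y hy, smul_eq_mul]
    rw [h2, sub_eq_zero]
    refine Finset.sum_congr rfl fun i _ => ?_
    field_simp [(hρ0 y hy).ne']
  have hPP : ContDiffOn ℝ ∞ (fun y => -B (P y) (P y)) V := (contDiffOn_bilin B hP hP).neg
  have hev : ∀ᶠ y in 𝓝 x, y ∈ V ∧ 0 < -B (P y) (P y) :=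
    (hV.eventually_mem hx).and ((hPP.continuousOn.continuousAt (hV.mem_nhds hx)).eventually_const_lt
      (by simp [hPx, hn₀]))
  obtain ⟨V', hV', hV'o, hxV'⟩ := eventually_nhds_iff.1 hev
  have hsub : V' ⊆ V := fun y hy => (hV' y hy).1
  have hsq : ContDiffOn ℝ ∞ (fun y => √(-B (P y) (P y))) V' :=
    (hPP.mono hsub).sqrt fun y hy => (hV' y hy).2.ne'
  refine ⟨V', hsub, hxV', fun y => (√(-B (P y) (P y)))⁻¹ • P y, by simp [hPx, hn₀], hB, hV'o,
    hf.mono hsub, hρ.mono hsub,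
    (hsq.inv fun y hy => (Real.sqrt_pos.2 (hV' y hy).2).ne').smul (hP.mono hsub),
    fun y hy => hρ0 y (hsub hy), fun y hy => hc y (hsub hy), fun y hy => ?_, fun y hy v => ?_⟩
  · have h1 := Real.sqrt_pos.2 (hV' y hy).2
    have h2 := Real.sq_sqrt (hV' y hy).2.le
    simp only [map_smul, smul_apply, smul_eq_mul]
    field_simp
    linarith
  · simp [hPf y (hsub hy)]

/-- The derivative of a unit normal field at a point depends only on its value there. -/
theorem IsConformalImmersion.dirDeriv_normal_unique [FiniteDimensional ℝ W]
    (H : IsConformalImmersion B V f ρ N) (hx : x ∈ V)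
    (hd : Module.finrank ℝ W = Module.finrank ℝ E + 1) {N' : E → W}
    (hN' : DifferentiableAt ℝ N' x)
    (h : ∀ᶠ y in 𝓝 x, B (N' y) (N' y) = -1 ∧ ∀ w, B (N' y) (dirDeriv w f y) = 0)
    (hNx : N' x = N x) (v : E) : dirDeriv v N' x = dirDeriv v N x := by
  obtain ⟨V', hV', hV'o, hxV'⟩ := eventually_nhds_iff.1 h
  have h1 := dirDeriv_congr hV'o (fun y hy => (hV' y hy).1) v hxV'
  rw [dirDeriv_bilin B hN' hN', dirDeriv_const, H.symm (dirDeriv v N' x), hNx] at h1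
  rw [← sub_eq_zero]
  refine H.eq_zero_of_bilin_eq_zero hx hd ?_ fun w => ?_
  · rw [map_sub, H.bilin_normal_dirDeriv hx]
    linarith
  · have h2 := dirDeriv_congr hV'o (fun y hy => (hV' y hy).2 w) v hxV'
    rw [dirDeriv_bilin B hN' (H.differentiableAt_dirDeriv hx w), dirDeriv_const, hNx, H.symm,
      H.symm (N x), H.bilin_dirDeriv_normal hx] at h2
    rw [map_sub]
    linarith

end Normal

/-! ### Transfer between the manifold and a chart. -/

section Manifold

/-- The Lorentzian scalar product as a continuous bilinear map. -/
noncomputable def formL (n : ℕ) : Space n →L[ℝ] Space n →L[ℝ] ℝ :=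
  (LinearMap.mk₂ ℝ (form (n := n))
    (fun x y z => by simp only [form, PiLp.add_apply, add_mul, Finset.sum_add_distrib]; ring)
    (fun c x y => by
      simp only [form, PiLp.smul_apply, smul_eq_mul, mul_assoc, ← Finset.mul_sum, mul_sub])
    (fun x y z => by simp only [form, PiLp.add_apply, mul_add, Finset.sum_add_distrib]; ring)
    (fun c x y => by
      simp only [form, PiLp.smul_apply, smul_eq_mul, mul_left_comm _ c, ← Finset.mul_sum, mul_sub])
    ).toContinuousBilinearMap

theorem form_comm {n : ℕ} (x y : Space n) : form x y = form y x := by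
  simp only [form, mul_comm]

variable {n : ℕ} {M : Type*} [TopologicalSpace M] [ChartedSpace (EuclideanSpace ℝ (Fin n)) M]
  {e : OpenPartialHomeomorph M (EuclideanSpace ℝ (Fin n))} {q : M}

theorem chart_mdifferentiable (he : e ∈ IsManifold.maximalAtlas (𝓡 n) ∞ M) :
    e.MDifferentiable (𝓡 n) (𝓡 n) :=
  ⟨(contMDiffOn_of_mem_maximalAtlas he).mdifferentiableOn (by simp),
    (contMDiffOn_symm_of_mem_maximalAtlas he).mdifferentiableOn (by simp)⟩

theorem chartDifferential_bijective [IsManifold (𝓡 n) ∞ M]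
    (he : e ∈ IsManifold.maximalAtlas (𝓡 n) ∞ M)
    (hq : q ∈ e.source) : Function.Bijective (chartDifferential e q) :=
  (chart_mdifferentiable he).mfderiv_bijective hq

variable {G : Type*} [NormedAddCommGroup G] [NormedSpace ℝ G]

theorem mfderiv_comp_chart [IsManifold (𝓡 n) ∞ M]
    (he : e ∈ IsManifold.maximalAtlas (𝓡 n) ∞ M) (hq : q ∈ e.source)
    {g : EuclideanSpace ℝ (Fin n) → G} (hg : DifferentiableAt ℝ g (e q))
    (w : TangentSpace (𝓡 n) q) :
    mfderiv (𝓡 n) 𝓘(ℝ, G) (g ∘ e) q w = dirDeriv (chartDifferential e q w) g (e q) := by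
  rw [mfderiv_comp q hg.mdifferentiableAt ((chart_mdifferentiable he).mdifferentiableAt hq),
    mfderiv_eq_fderiv]
  rfl

theorem mfderiv_eq_dirDeriv [IsManifold (𝓡 n) ∞ M]
    (he : e ∈ IsManifold.maximalAtlas (𝓡 n) ∞ M) (hq : q ∈ e.source)
    {F : M → G} (hF : DifferentiableAt ℝ (F ∘ e.symm) (e q)) (w : TangentSpace (𝓡 n) q) :
    mfderiv (𝓡 n) 𝓘(ℝ, G) F q w = dirDeriv (chartDifferential e q w) (F ∘ e.symm) (e q) := by
  rw [← mfderiv_comp_chart he hq hF]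
  have : F =ᶠ[𝓝 q] (F ∘ e.symm) ∘ e := by
    filter_upwards [e.open_source.mem_nhds hq] with y hy
    simp [e.left_inv hy]
  rw [this.mfderiv_eq]
  rfl

theorem contDiffAt_comp_symm (he : e ∈ IsManifold.maximalAtlas (𝓡 n) ∞ M) (hq : q ∈ e.source)
    {F : M → G} (hF : ContMDiffAt (𝓡 n) 𝓘(ℝ, G) ∞ F q) :
    ContDiffAt ℝ ∞ (F ∘ e.symm) (e q) := by
  refine ContMDiffAt.contDiffAt (ContMDiffAt.comp (e q) (I' := 𝓡 n) ?_
    (contMDiffAt_symm_of_mem_maximalAtlas he (e.map_source hq)))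
  rwa [e.left_inv hq]

theorem contMDiffOn_comp_chart (he : e ∈ IsManifold.maximalAtlas (𝓡 n) ∞ M)
    {V : Set (EuclideanSpace ℝ (Fin n))} {g : EuclideanSpace ℝ (Fin n) → G}
    (hg : ContDiffOn ℝ ∞ g V) :
    ContMDiffOn (𝓡 n) 𝓘(ℝ, G) ∞ (g ∘ e) (e.source ∩ e ⁻¹' V) :=
  hg.contMDiffOn.comp ((contMDiffOn_of_mem_maximalAtlas he).mono Set.inter_subset_left)
    fun _ hy => hy.2

end Manifold

end Minkowski

theorem theorem5p7 {n : ℕ} (hn : 4 ≤ n) {M : Type*} [TopologicalSpace M]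
    [ChartedSpace (EuclideanSpace ℝ (Fin n)) M] [IsManifold (𝓡 n) ∞ M]
    (F : M → Minkowski.Space n) (hF : Minkowski.IsSpacelikeHypersurface F)
    (hflat : Minkowski.IsConformallyFlat (Minkowski.inducedMetric F))
    (humb : ∀ q : M, ¬ Minkowski.IsUmbilicalPoint F q)
    (p : M) (hp : Minkowski.HasShapeRankAtLeastTwo F p) :
    ∃ U : Set M, IsOpen U ∧ p ∈ U ∧ Minkowski.IsCanalOn F U := by
  open Minkowski in
  obtain ⟨e, he, hpe, lam, hlam, hconf⟩ := hflat p
  obtain ⟨A, ⟨N₀, hN₀, hN₀n, hN₀A⟩, hrank⟩ := hp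
  have hd : Module.finrank ℝ (Space n) = Module.finrank ℝ (EuclideanSpace ℝ (Fin n)) + 1 := by simp
  let f : EuclideanSpace ℝ (Fin n) → Space n := F ∘ e.symm
  have hsrc {y : EuclideanSpace ℝ (Fin n)} (hy : y ∈ e.target) :
      e.symm y ∈ e.source := e.map_target hy
  have hf : ContDiffOn ℝ ∞ f e.target := fun y hy => by
    have := contDiffAt_comp_symm he (hsrc hy) (hF.1 (e.symm y))
    rw [e.right_inv hy] at this
    exact this.contDiffWithinAt
  have hlam' : ContDiffOn ℝ ∞ (lam ∘ e.symm) e.target := fun y hy => by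
    have := contDiffAt_comp_symm he (hsrc hy)
      (hlam.contMDiffAt (e.open_source.mem_nhds (hsrc hy)))
    rw [e.right_inv hy] at this
    exact this.contDiffWithinAt
  have hfd {q : M} (hq : q ∈ e.source) : DifferentiableAt ℝ f (e q) :=
    differentiableAt_of_contDiffOn e.open_target hf (e.map_source hq)
  have hdF {q : M} (hq : q ∈ e.source) (w : TangentSpace (𝓡 n) q) :
      differential F q w = dirDeriv (chartDifferential e q w) f (e q) :=
    mfderiv_eq_dirDeriv he hq (hfd hq) w
  have hc (y) (hy : y ∈ e.target) (v w : EuclideanSpace ℝ (Fin n)) :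
      formL n (dirDeriv v f y) (dirDeriv w f y) = (lam ∘ e.symm) y * inner ℝ v w := by
    obtain ⟨v', rfl⟩ := (chartDifferential_bijective he (hsrc hy)).2 v
    obtain ⟨w', rfl⟩ := (chartDifferential_bijective he (hsrc hy)).2 w
    have h1 := (hconf _ (hsrc hy)).2 v' w'
    rwa [inducedMetric, hdF (hsrc hy), hdF (hsrc hy), e.right_inv hy] at h1
  have hnormal {q : M} (hq : q ∈ e.source) {X : Space n}
      (h : ∀ w : TangentSpace (𝓡 n) q, form X (differential F q w) = 0)
      (w : EuclideanSpace ℝ (Fin n)) : formL n X (dirDeriv w f (e q)) = 0 := by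
    obtain ⟨w', rfl⟩ := (chartDifferential_bijective he hq).2 w
    rw [← hdF hq]
    exact h w'
  obtain ⟨hN₀u, hN₀t⟩ := hN₀n.self_of_nhds
  -- Smoothness of `N₀` is known only at `p`, so a normal field smooth on a whole neighbourhood is
  -- rebuilt from its value there.
  obtain ⟨V, hVe, hxV, N, hNx, H⟩ := exists_isConformalImmersion (B := formL n) form_comm
    e.open_target hf hlam' (fun y hy => (hconf _ (hsrc hy)).1) hc (e.map_source hpe) hN₀u
    (hnormal hpe hN₀t)
  have hNd {q : M} (hq : e q ∈ V) : DifferentiableAt ℝ N (e q) := H.differentiableAt_normal hq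
  have humb' (y) (hy : y ∈ V) : ¬ ∃ c : ℝ, ∀ v, dirDeriv v N y = c • dirDeriv v f y := by
    rintro ⟨c, hcy⟩
    have hq := hsrc (hVe hy)
    have hqy := e.right_inv (hVe hy)
    have hqV : e (e.symm y) ∈ V := hqy.symm ▸ hy
    have hopen := e.isOpen_inter_preimage H.isOpen
    refine humb (e.symm y) ⟨(-c) • LinearMap.id, ⟨N ∘ e, ?_, ?_, fun v => ?_⟩, -c, fun v => rfl⟩
    · exact (contMDiffOn_comp_chart he H.smooth_normal).contMDiffAt (hopen.mem_nhds ⟨hq, hqV⟩)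
    · filter_upwards [hopen.mem_nhds ⟨hq, hqV⟩] with q' hq'
      refine ⟨H.unit _ hq'.2, fun w => ?_⟩
      rw [hdF hq'.1]
      exact H.normal _ hq'.2 _
    · have h1 : differential (N ∘ e) (e.symm y) v =
          dirDeriv (chartDifferential e (e.symm y) v) N (e (e.symm y)) :=
        mfderiv_comp_chart he hq (hNd hqV) v
      rw [h1, hqy, hcy, LinearMap.smul_apply, map_smul, hdF hq, hqy, neg_smul]
      rfl
  have hrank' : ¬ ∃ X : Space n, ∀ v, ∃ c : ℝ, dirDeriv v N (e p) = c • X := by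
    rintro ⟨X, hX⟩
    have hN₀' := contDiffAt_comp_symm he hpe hN₀
    have hN₀d : DifferentiableAt ℝ (N₀ ∘ e.symm) (e p) := hN₀'.differentiableAt (by simp)
    have hev : ∀ᶠ y in 𝓝 (e p), formL n ((N₀ ∘ e.symm) y) ((N₀ ∘ e.symm) y) = -1 ∧
        ∀ w, formL n ((N₀ ∘ e.symm) y) (dirDeriv w f y) = 0 := by
      have hcont := e.continuousAt_symm (e.map_source hpe)
      rw [ContinuousAt, e.left_inv hpe] at hcont
      filter_upwards [hcont.eventually hN₀n, e.open_target.mem_nhds (e.map_source hpe)] with y hy hye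
      refine ⟨hy.1, fun w => ?_⟩
      have := hnormal (hsrc hye) hy.2 w
      rwa [e.right_inv hye] at this
    have hAX (v : TangentSpace (𝓡 n) p) : differential F p (A v) ∈ Submodule.span ℝ {X} := by
      obtain ⟨c, hcX⟩ := hX (chartDifferential e p v)
      have h1 : differential N₀ p v = c • X := by
        rw [← hcX, ← H.dirDeriv_normal_unique hxV hd hN₀d hev (by simp [hNx, e.left_inv hpe])]
        exact mfderiv_eq_dirDeriv he hpe hN₀d v
      rw [hN₀A, h1]
      exact Submodule.neg_mem _ (Submodule.smul_mem _ _ (Submodule.mem_span_singleton_self X))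
    -- dF is injective, so the range of `A` has the dimension of its image, which lies in the line
    -- spanned by `X`; this contradicts rank at least two.
    let D : TangentSpace (𝓡 n) p →ₗ[ℝ] Space n := (differential F p).toLinearMap
    have hDinj : Function.Injective D := (injective_iff_map_eq_zero D).2 fun v hv => by
      by_contra hv0
      have h1 := hF.2 p v hv0
      rw [inducedMetric, show differential F p v = 0 from hv] at h1
      simp [form] at h1
    have h2 := (Submodule.equivMapOfInjective D hDinj (LinearMap.range A)).finrank_eq
    have h3 : (LinearMap.range A).map D ≤ Submodule.span ℝ {X} := by
      rintro _ ⟨_, ⟨v, rfl⟩, rfl⟩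
      exact hAX v
    have h4 : Module.finrank ℝ (Submodule.span ℝ {X}) ≤ 1 := by
      simpa using finrank_span_le_card (R := ℝ) ({X} : Set (Space n))
    have h5 := Submodule.finrank_mono h3
    omega
  obtain ⟨U, hUV, hU, hxU, J, s, z, R, v, c, hJ, hJc, hsU, hs, hds, hz, hR, hv, hcs, hRv, hfin⟩ :=
    H.exists_canal hxV hd (by simpa using hn) humb' hrank'
  refine ⟨e.source ∩ e ⁻¹' U, e.isOpen_inter_preimage hU, ⟨hpe, hxU⟩, J, s ∘ e, z, R, v, c, hJ, hJc,
    ?_, contMDiffOn_comp_chart he hs, fun q hq h0 => ?_, hz, hR, hv, hcs, hRv, fun q hq => ?_⟩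
  · rw [Set.image_comp, ← hsU]
    congr 1
    ext y
    constructor
    · rintro ⟨q, hq, rfl⟩
      exact hq.2
    · intro hy
      have hye := hVe (hUV hy)
      exact ⟨e.symm y, ⟨hsrc hye, by rwa [Set.mem_preimage, e.right_inv hye]⟩, e.right_inv hye⟩
  · refine hds _ hq.2 (ContinuousLinearMap.ext fun w => ?_)
    obtain ⟨w', rfl⟩ := (chartDifferential_bijective he hq.1).2 w
    have := mfderiv_comp_chart he hq.1 (differentiableAt_of_contDiffOn hU hs hq.2) w'
    rw [h0] at this
    exact this.symm
  · have hfq : f (e q) = F q := by simp [f, e.left_inv hq.1]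
    obtain ⟨h1, h2, h3⟩ := hfin _ hq.2
    rw [hfq] at h1 h2 h3
    refine ⟨⟨h1, h2⟩, fun w => ?_⟩
    rw [hdF hq.1]
    exact h3 _
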